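/- Let $M\ge 1$, $T_{dl}\ge 0$ and $s\ge 0$ be integers. Let $f_0,\dots,f_{M-1}\in\mathbb C^M$ be the columns of the unitary $M\times M$ DFT matrix, whose $(m,n)$ entry is $M^{-1/2}e^{-2\pi i mn/M}$. For $\lambda\in[0,\infty)^M$ let $\mathcal S=\{m:\lambda_m\neq 0\}$ be its support and consider the sparse Gaussian channel vector $$h=\sum_{m=0}^{M-1} g_m\sqrt{\lambda_m}\,f_m=\sum_{m\in\mathcal S} g_m\sqrt{\lambda_m}\,f_m ,$$ where the $g_m\sim\mathcal{CN}(0,1)$ are i.i.d. It is observed through $y=\Psi h+n$, where $\Psi\in\mathbb C^{T_{dl}\times M}$ is a deterministic pilot matrix and $n\sim\mathcal{CN}(0,N_0 I_{T_{dl}})$, $N_0>0$, is independent of $(g_m)$. For an estimator $\widehat h$ of $h$, i.e. a measurable function of $y$ with finite second moments, let $R_e=\mathbb E[(h-\widehat h)(h-\widehat h)^{\mathsf H}]$ be the error covariance matrix. The MMSE estimator is $\widehat h=\mathbb E[h\mid y]$. 1. If $T_{dl}\ge s$, then for every $P_{dl}>0$ there exists a pilot matrix $\Psi\in\mathbb C^{T_{dl}\times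 M}$ with $\operatorname{tr}(\Psi\Psi^{\mathsf H})=T_{dl}P_{dl}$ such that, for every support set $\mathcal S$ with $|\mathcal S|=s$ and every $\lambda$ with support $\mathcal S$, the MMSE estimator satisfies $\lim_{N_0\downarrow 0}\operatorname{tr}(R_e)=0$. 2. Conversely, if $T_{dl}<s$, then for every support set $\mathcal S$ with $|\mathcal S|=s$, every $\lambda$ with support $\mathcal S$ and every pilot matrix $\Psi\in\mathbb C^{T_{dl}\times M}$, the limit $c=\lim_{N_0\downarrow 0}\operatorname{tr}(R_e)$ for the MMSE estimator exists and $c>0$; moreover every estimator satisfies $\operatorname{tr}(R_e)\ge c$ for every $N_0>0$, so the error of no estimator vanishes as $N_0\downarrow 0$. -/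

import Mathlib

open MeasureTheory ProbabilityTheory Filter Topology Matrix
open scoped ComplexConjugate

noncomputable section

/-- The circularly symmetric complex Gaussian law `CN(0, v)`: independent real and imaginary
parts, each real Gaussian of mean `0` and variance `v / 2`. -/
def complexGaussian (v : ℝ) : Measure ℂ :=
  ((gaussianReal 0 (v / 2).toNNReal).prod (gaussianReal 0 (v / 2).toNNReal)).map
    (fun p : ℝ × ℝ => (⟨p.1, p.2⟩ : ℂ))

/-- The unitary `M × M` DFT matrix, with entries `exp (-2πi m n / M) / √M`, `0 ≤ m, n < M`. -/
def dftMatrix (M : ℕ) : Matrix (Fin M) (Fin M) ℂ :=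
  Matrix.of fun m n =>
    (1 / (Real.sqrt M : ℂ)) *
      Complex.exp (-Complex.I * 2 * Real.pi * ((m : ℕ) : ℂ) * ((n : ℕ) : ℂ) / (M : ℂ))

/-- The channel vector `h = ∑ m, g m * √(lam m) • f m`, with `f m` the `m`-th column of the DFT
matrix. The indices outside the support of `lam` contribute `0`. -/
def channel {Ω : Type*} {M : ℕ} (lam : Fin M → ℝ) (g : Fin M → Ω → ℂ) (ω : Ω) : Fin M → ℂ :=
  fun i => ∑ m, g m ω * (Real.sqrt (lam m) : ℂ) * dftMatrix M i m

/-- The observation `y = Ψ h + n`. -/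
def observation {Ω : Type*} {M T : ℕ} (Ψ : Matrix (Fin T) (Fin M) ℂ) (h : Ω → Fin M → ℂ)
    (n : Fin T → Ω → ℂ) (ω : Ω) : Fin T → ℂ :=
  fun t => (Ψ *ᵥ h ω) t + n t ω

/-- Distributional assumptions: the coefficients `g m` are i.i.d. `CN(0, 1)`, the noise is
`CN(0, N₀ I)`, and noise and coefficients are independent. -/
structure IsGaussianModel {Ω : Type*} [MeasurableSpace Ω] {M T : ℕ} (P : Measure Ω) (N₀ : ℝ)
    (g : Fin M → Ω → ℂ) (n : Fin T → Ω → ℂ) : Prop where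
  measurable_coeff : ∀ m, Measurable (g m)
  measurable_noise : ∀ t, Measurable (n t)
  law_coeff : ∀ m, P.map (g m) = complexGaussian 1
  law_noise : ∀ t, P.map (n t) = complexGaussian N₀
  indep : iIndepFun (Sum.elim g n : Fin M ⊕ Fin T → Ω → ℂ) P

/-- The MMSE estimator: the (entrywise) conditional expectation of `h` given the σ-algebra
generated by the observation `y`. -/
def mmseEstimator {Ω : Type*} [MeasurableSpace Ω] {M T : ℕ} (P : Measure Ω)
    (h : Ω → Fin M → ℂ) (y : Ω → Fin T → ℂ) (ω : Ω) : Fin M → ℂ :=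
  fun i => (P[fun ω' => h ω' i | MeasurableSpace.comap y inferInstance]) ω

/-- The estimation error covariance matrix `E[(h - hhat) (h - hhat)ᴴ]`. -/
def errorCov {Ω : Type*} [MeasurableSpace Ω] {M : ℕ} (P : Measure Ω)
    (h hhat : Ω → Fin M → ℂ) : Matrix (Fin M) (Fin M) ℂ :=
  Matrix.of fun i j => ∫ ω, (h ω i - hhat ω i) * conj (h ω j - hhat ω j) ∂P

end

/-! Write `h = B g` with `B = channelMatrix lam`, so that `y = A g + n` with `A = Ψ B`. Let `Q` be
the orthogonal projection onto `ker A`. The limiting error is the squared Frobenius norm of `B Q`,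
called `residualError`; neither the Gaussian posterior nor a closed form of the MMSE estimator is
needed.

Upper bound (`mmse_le`): with `G A = 1 - Q`, the linear estimator `B G y` has error `B Q g - B G n`,
of mean square `‖B Q‖² + N₀ ‖B G‖²`, and the MMSE estimator does no worse.

Lower bound (`residualError_le`): the reflection `U = 1 - 2Q` is unitary and `A U = A`. Hence `(g,
n)` and `(U g, n)` have the same law and produce the same `y`, while `B g` and `B U g` differ by `2
B Q g`. An estimator must serve both, so its error is at least `‖B Q‖²`, for every `N₀ > 0`.

It remains to decide whether `B` vanishes on `ker A`. If `T ≥ s`, observing the first entries of `h`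
suffices: the first `s` rows of any `s` DFT columns form, up to scaling, an invertible Vandermonde
matrix. If `T < s`, `A` kills a nonzero vector supported on `S`, and `B` is injective on such
vectors. -/

/-! ### Linear algebra of the kernel. -/

/-- Every matrix `A` has an orthogonal projection `Q` onto its kernel, and a left inverse `G`
modulo that projection. -/
lemma Matrix.exists_kernel_projection {M T : ℕ} (A : Matrix (Fin T) (Fin M) ℂ) :
    ∃ (Q : Matrix (Fin M) (Fin M) ℂ) (G : Matrix (Fin M) (Fin T) ℂ),
      Qᴴ = Q ∧ Q * Q = Q ∧ A * Q = 0 ∧ G * A = 1 - Q := by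
  set K : Submodule ℂ (EuclideanSpace ℂ (Fin M)) := LinearMap.ker (toEuclideanLin A) with hK
  set Q : Matrix (Fin M) (Fin M) ℂ := (toEuclideanCLM (𝕜 := ℂ)).symm K.starProjection with hQ
  have hQK : toEuclideanCLM (𝕜 := ℂ) Q = K.starProjection := by simp [hQ]
  have hQv (v : EuclideanSpace ℂ (Fin M)) : WithLp.toLp 2 (Q *ᵥ v.ofLp) = K.starProjection v := by
    rw [← hQK]; rfl
  have hA (v : EuclideanSpace ℂ (Fin M)) : v ∈ K ↔ A *ᵥ v.ofLp = 0 := by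
    rw [hK, LinearMap.mem_ker, toLpLin_apply, WithLp.toLp_eq_zero]
  have hfix (v : Fin M → ℂ) (hv : A *ᵥ v = 0) : Q *ᵥ v = v := by
    have h1 : WithLp.toLp 2 v ∈ K := (hA _).2 hv
    have h2 := hQv (WithLp.toLp 2 v)
    rw [K.starProjection_eq_self_iff.2 h1] at h2
    exact WithLp.toLp_injective 2 h2
  have hQQ : Q * Q = Q := by
    have := K.isIdempotentElem_starProjection
    rw [IsIdempotentElem, ← hQK, ← map_mul] at this
    exact (toEuclideanCLM (𝕜 := ℂ)).injective this
  have hQs : Qᴴ = Q := by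
    have := isSelfAdjoint_starProjection K
    rw [IsSelfAdjoint, ← hQK, ← map_star] at this
    exact (toEuclideanCLM (𝕜 := ℂ)).injective this
  have hAQ : A * Q = 0 := by
    refine Matrix.ext_of_mulVec_single fun i => ?_
    rw [← mulVec_mulVec, zero_mulVec]
    have h1 : K.starProjection (WithLp.toLp 2 (Pi.single i 1)) ∈ K :=
      K.starProjection_apply_mem _
    rw [← hQv] at h1
    exact (hA _).1 h1
  have hker : LinearMap.ker (toLin' A) ≤ LinearMap.ker (toLin' (1 - Q)) := by
    intro v hv
    simp only [LinearMap.mem_ker, toLin'_apply] at hv ⊢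
    rw [sub_mulVec, one_mulVec, hfix v hv, sub_self]
  -- Since `1 - Q` vanishes on `ker A`, it factors through the range of `A`; any linear extension of
  -- that factor to the whole space serves as `G`.
  obtain ⟨g, hg⟩ := LinearMap.exists_extend
    (((LinearMap.ker (toLin' A)).liftQ (toLin' (1 - Q)) hker) ∘ₗ
      (toLin' A).quotKerEquivRange.symm.toLinearMap)
  refine ⟨Q, LinearMap.toMatrix' g, hQs, hQQ, hAQ, ?_⟩
  apply toLin'.injective
  rw [toLin'_mul, toLin'_toMatrix']
  refine LinearMap.pi_ext' fun v => LinearMap.ext_ring ?_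
  have h := LinearMap.congr_fun hg ⟨toLin' A (Pi.single v 1), LinearMap.mem_range_self _ _⟩
  rw [LinearMap.comp_apply, LinearMap.comp_apply, LinearEquiv.coe_coe,
    LinearMap.quotKerEquivRange_symm_apply_image] at h
  simpa using h

/-- Dimension count on the columns of `A` indexed by `S`: more unknowns than equations. The kernel
vector is extended by zero. -/
lemma Matrix.exists_support_subset_mulVec_eq_zero {M T : ℕ} (A : Matrix (Fin T) (Fin M) ℂ)
    (S : Finset (Fin M)) (hS : T < S.card) :
    ∃ v : Fin M → ℂ, v ≠ 0 ∧ (∀ m, m ∉ S → v m = 0) ∧ A *ᵥ v = 0 := by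
  have hlt : Module.finrank ℂ (Fin T → ℂ) < Module.finrank ℂ (S → ℂ) := by simpa using hS
  obtain ⟨w, hw, hw0⟩ := (Submodule.ne_bot_iff _).1
    (LinearMap.ker_ne_bot_of_finrank_lt (f := toLin' (A.submatrix id ((↑) : S → Fin M))) hlt)
  refine ⟨fun m => if h : m ∈ S then w ⟨m, h⟩ else 0, ?_, fun m hm => by simp [hm], ?_⟩
  · intro h
    refine hw0 (funext fun m => ?_)
    simpa using congrFun h m
  · ext t
    have h := congrFun (LinearMap.mem_ker.1 hw) t
    simp only [toLin'_apply, mulVec, dotProduct, submatrix_apply, id, Pi.zero_apply] at h ⊢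
    rw [← Finset.sum_subset S.subset_univ (fun m _ hm => by rw [dif_neg hm, mul_zero]),
      ← Finset.sum_coe_sort S, ← h]
    simp

/-! ### The DFT matrix as a Vandermonde matrix. -/

/-- The node of the `m`-th column of the DFT matrix, seen as a Vandermonde matrix. -/
noncomputable def dftNode (M : ℕ) (m : Fin M) : ℂ :=
  Complex.exp (-Complex.I * 2 * Real.pi * ((m : ℕ) : ℂ) / (M : ℂ))

lemma dftMatrix_apply {M : ℕ} (k m : Fin M) :
    dftMatrix M k m = (1 / (Real.sqrt M : ℂ)) * dftNode M m ^ (k : ℕ) := by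
  rw [dftMatrix, of_apply, dftNode, ← Complex.exp_nat_mul]
  congr 2
  ring

/-- Equal nodes force `b = a + k M` with `k` an integer; as `a` and `b` both lie in `[0, M)`, `k =
0`. -/
lemma dftNode_injective (M : ℕ) : Function.Injective (dftNode M) := by
  intro a b hab
  have hM : (M : ℂ) ≠ 0 := by
    have := a.pos
    exact_mod_cast this.ne'
  obtain ⟨k, hk⟩ := Complex.exp_eq_exp_iff_exists_int.1 hab
  have hpi : (2 * Real.pi * Complex.I : ℂ) ≠ 0 := Complex.two_pi_I_ne_zero
  have h1 : (2 * Real.pi * Complex.I : ℂ) * (b : ℕ) = (2 * Real.pi * Complex.I) * ((a : ℕ) + k * M) := by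
    field_simp at hk
    linear_combination (2 * Real.pi * Complex.I) * hk
  have h2 := mul_left_cancel₀ hpi h1
  have h3 : ((b : ℕ) : ℤ) = (a : ℕ) + k * M := by exact_mod_cast h2
  have ha := a.isLt
  have hb := b.isLt
  have hk0 : k = 0 := by
    by_contra hne
    rcases lt_or_gt_of_ne hne with h | h
    · nlinarith
    · nlinarith
  rw [hk0] at h3
  apply Fin.ext
  omega

/-- A vector supported on `S` is determined by the first `#S` entries of its DFT. -/
lemma eq_zero_of_dftMatrix_mulVec_eq_zero {M : ℕ} (S : Finset (Fin M)) (u : Fin M → ℂ)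
    (hu : ∀ m, m ∉ S → u m = 0)
    (h : ∀ k : Fin M, (k : ℕ) < S.card → (dftMatrix M *ᵥ u) k = 0) : u = 0 := by
  have hcard : S.card ≤ M := by simpa using S.card_le_univ
  let e := S.orderIsoOfFin rfl
  have hv : (fun i => u (e i)) = 0 := by
    refine Matrix.eq_zero_of_forall_pow_sum_mul_pow_eq_zero (f := fun i => dftNode M (e i))
      (fun i j hij => e.injective (Subtype.ext (dftNode_injective M hij))) fun i => ?_
    have hi := h ⟨i, i.isLt.trans_le hcard⟩ i.isLt
    have hM : (Real.sqrt M : ℂ) ≠ 0 := by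
      have : 0 < M := lt_of_lt_of_le i.pos hcard
      exact_mod_cast (Real.sqrt_pos.2 (by exact_mod_cast this)).ne'
    simp only [mulVec, dotProduct, dftMatrix_apply, mul_assoc, ← Finset.mul_sum] at hi
    have hi := (mul_eq_zero.1 hi).resolve_left (by simpa using hM)
    rw [← Finset.sum_subset S.subset_univ (fun m _ hm => by simp [hu m hm]),
      ← Finset.sum_coe_sort S, ← e.toEquiv.sum_comp] at hi
    rw [← hi]
    exact Finset.sum_congr rfl fun _ _ => mul_comm _ _
  ext m
  by_cases hm : m ∈ S
  · simpa using congrFun hv (e.symm ⟨m, hm⟩)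
  · exact hu m hm

/-! ### Complex Gaussian laws. -/

instance isProbabilityMeasure_complexGaussian (v : ℝ) : IsProbabilityMeasure (complexGaussian v) := by
  unfold complexGaussian
  exact Measure.isProbabilityMeasure_map Complex.measurableEquivRealProd.symm.measurable.aemeasurable

/-- Each real component has variance `v / 2`, whence the factor `1 / 4`. Dependence on `‖t‖` alone
is what yields unitary invariance. -/
lemma charFun_complexGaussian (v : ℝ) (hv : 0 ≤ v) (t : ℂ) :
    charFun (complexGaussian v) t = Complex.exp (-(v * ‖t‖ ^ 2 / 4 : ℝ)) := by
  have hm : Measurable (fun p : ℝ × ℝ => (⟨p.1, p.2⟩ : ℂ)) :=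
    Complex.measurableEquivRealProd.symm.measurable
  rw [charFun_apply, complexGaussian, integral_map hm.aemeasurable
    (Measurable.aestronglyMeasurable (by fun_prop))]
  have h1 (p : ℝ × ℝ) : Complex.exp ((inner ℝ (⟨p.1, p.2⟩ : ℂ) t : ℝ) * Complex.I) =
      Complex.exp ((inner ℝ p.1 t.re : ℝ) * Complex.I) *
        Complex.exp ((inner ℝ p.2 t.im : ℝ) * Complex.I) := by
    rw [← Complex.exp_add, Complex.inner]
    congr 1
    simp
    ring
  simp_rw [h1]
  rw [integral_prod_mul (μ := gaussianReal 0 (v / 2).toNNReal)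
    (ν := gaussianReal 0 (v / 2).toNNReal)
    (fun x : ℝ => Complex.exp ((inner ℝ x t.re : ℝ) * Complex.I))
    (fun x : ℝ => Complex.exp ((inner ℝ x t.im : ℝ) * Complex.I)), ← charFun_apply,
    ← charFun_apply, charFun_gaussianReal, charFun_gaussianReal, ← Complex.exp_add]
  have h2 : (((v / 2).toNNReal : ℝ) : ℂ) = v / 2 := by
    rw [Real.coe_toNNReal _ (by positivity)]; push_cast; rfl
  congr 1
  rw [Complex.sq_norm, Complex.normSq_apply, h2]
  push_cast
  ring

lemma EuclideanSpace.real_inner_eq_re_inner {ι : Type*} [Fintype ι] (x y : EuclideanSpace ℂ ι) :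
    inner ℝ x y = (inner ℂ x y).re := by
  simp [PiLp.inner_apply, Complex.inner, mul_comm]

/-- The law of a vector of i.i.d. complex Gaussians is invariant under unitary matrices. -/
lemma map_mulVec_pi_complexGaussian {ι : Type*} [Fintype ι] [DecidableEq ι] {v : ℝ} (hv : 0 ≤ v)
    (U : Matrix ι ι ℂ) (hU : U * Uᴴ = 1) :
    (Measure.pi fun _ : ι => complexGaussian v).map (fun x => U *ᵥ x) =
      Measure.pi fun _ : ι => complexGaussian v := by
  set μ := Measure.pi fun _ : ι => complexGaussian v
  have hUm : Measurable (fun x : ι → ℂ => U *ᵥ x) :=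
    (continuous_const.matrix_mulVec continuous_id).measurable
  have : IsProbabilityMeasure (μ.map (fun x => U *ᵥ x)) :=
    Measure.isProbabilityMeasure_map hUm.aemeasurable
  have hμ (t : EuclideanSpace ℂ ι) :
      charFun (μ.map (WithLp.toLp 2)) t = Complex.exp (-(v * ‖t‖ ^ 2 / 4 : ℝ)) := by
    rw [charFun_pi]
    simp_rw [charFun_complexGaussian v hv]
    rw [← Complex.exp_sum, EuclideanSpace.norm_sq_eq, Finset.mul_sum, Finset.sum_div]
    push_cast
    rw [Finset.sum_neg_distrib]
  refine (MeasurableEquiv.toLp 2 (ι → ℂ)).map_measurableEquiv_injective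
    (Measure.ext_of_charFun (E := EuclideanSpace ℂ ι) (funext fun t => ?_))
  rw [MeasurableEquiv.coe_toLp]
  set V := toEuclideanCLM (𝕜 := ℂ) U
  have hVV (x : EuclideanSpace ℂ ι) : V (star V x) = x := by
    have : V * star V = 1 := by rw [← map_star, ← map_mul]; simp [star_eq_conjTranspose, hU]
    exact DFunLike.congr_fun this x
  have hnorm : ‖star V t‖ = ‖t‖ := by
    have : ‖star V t‖ ^ 2 = ‖t‖ ^ 2 := by
      rw [← RCLike.ofReal_inj (K := ℂ)]
      push_cast
      rw [← inner_self_eq_norm_sq_to_K (𝕜 := ℂ), ← inner_self_eq_norm_sq_to_K (𝕜 := ℂ)]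
      rw [ContinuousLinearMap.star_eq_adjoint, ContinuousLinearMap.adjoint_inner_left,
        ← ContinuousLinearMap.star_eq_adjoint, hVV]
    exact (sq_eq_sq₀ (norm_nonneg _) (norm_nonneg _)).1 this
  -- Passing to the adjoint moves `U` from the random vector to the argument, whose norm is
  -- preserved.
  have hcomp : charFun ((μ.map fun x => U *ᵥ x).map (WithLp.toLp 2)) t =
      charFun (μ.map (WithLp.toLp 2)) (star V t) := by
    have hm : Measurable (WithLp.toLp 2 : (ι → ℂ) → EuclideanSpace ℂ ι) := by fun_prop
    rw [Measure.map_map hm hUm, charFun_apply, charFun_apply,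
      integral_map (hm.comp hUm).aemeasurable (Measurable.aestronglyMeasurable (by fun_prop)),
      integral_map hm.aemeasurable (Measurable.aestronglyMeasurable (by fun_prop))]
    congr 1 with x
    congr 3
    change inner ℝ (V (WithLp.toLp 2 x)) t = inner ℝ (WithLp.toLp 2 x) (star V t)
    rw [EuclideanSpace.real_inner_eq_re_inner, EuclideanSpace.real_inner_eq_re_inner,
      ContinuousLinearMap.star_eq_adjoint, ContinuousLinearMap.adjoint_inner_right]
  rw [hcomp, hμ, hμ, hnorm]

lemma memLp_complexGaussian (v : ℝ) : MemLp id 2 (complexGaussian v) := by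
  have hm : Measurable (fun p : ℝ × ℝ => (⟨p.1, p.2⟩ : ℂ)) :=
    Complex.measurableEquivRealProd.symm.measurable
  rw [complexGaussian, memLp_map_measure_iff aestronglyMeasurable_id hm.aemeasurable]
  have h : MemLp (id : ℝ → ℝ) 2 (gaussianReal 0 (v / 2).toNNReal) := memLp_id_gaussianReal 2
  have h1 := (h.comp_fst (gaussianReal 0 (v / 2).toNNReal)).ofReal (K := ℂ)
  have h2 := (h.comp_snd (gaussianReal 0 (v / 2).toNNReal)).ofReal (K := ℂ)
  convert h1.add (h2.const_mul Complex.I) using 1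
  ext p
  simp [Complex.ext_iff]

lemma integral_id_complexGaussian (v : ℝ) : ∫ z, z ∂(complexGaussian v) = 0 := by
  have hm : Measurable (fun p : ℝ × ℝ => (⟨p.1, p.2⟩ : ℂ)) :=
    Complex.measurableEquivRealProd.symm.measurable
  have hint : Integrable (fun z => z) (complexGaussian v) :=
    (memLp_complexGaussian v).integrable (by norm_num)
  have hint' := (integrable_map_measure hint.aestronglyMeasurable hm.aemeasurable).1 hint
  rw [complexGaussian, integral_map hm.aemeasurable (Measurable.aestronglyMeasurable (by fun_prop))]
  have hre := integral_re hint'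
  have him := integral_im hint'
  apply Complex.ext
  · refine hre.symm.trans ?_
    have := integral_fun_fst (μ := gaussianReal 0 (v / 2).toNNReal)
      (ν := gaussianReal 0 (v / 2).toNNReal) (fun x : ℝ => x)
    simpa [integral_id_gaussianReal] using this
  · refine him.symm.trans ?_
    have := integral_fun_snd (μ := gaussianReal 0 (v / 2).toNNReal)
      (ν := gaussianReal 0 (v / 2).toNNReal) (fun x : ℝ => x)
    simpa [integral_id_gaussianReal] using this

lemma integral_sq_gaussianReal (v : NNReal) : ∫ x, x ^ 2 ∂(gaussianReal 0 v) = v := by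
  have h := variance_id_gaussianReal (μ := 0) (v := v)
  rw [variance_eq_integral aemeasurable_id] at h
  simpa [integral_id_gaussianReal] using h

lemma integral_norm_sq_complexGaussian {v : ℝ} (hv : 0 ≤ v) :
    ∫ z, ‖z‖ ^ 2 ∂(complexGaussian v) = v := by
  have hm : Measurable (fun p : ℝ × ℝ => (⟨p.1, p.2⟩ : ℂ)) :=
    Complex.measurableEquivRealProd.symm.measurable
  rw [complexGaussian, integral_map hm.aemeasurable
    (Measurable.aestronglyMeasurable (by fun_prop))]
  simp_rw [Complex.sq_norm, Complex.normSq_apply, ← sq]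
  have h : Integrable (fun x : ℝ => x ^ 2) (gaussianReal 0 (v / 2).toNNReal) :=
    (memLp_id_gaussianReal 2).integrable_sq
  rw [integral_add (h.comp_fst _) (h.comp_snd _),
    integral_fun_fst (fun x : ℝ => x ^ 2), integral_fun_snd (fun x : ℝ => x ^ 2)]
  simp [integral_sq_gaussianReal, max_eq_left (div_nonneg hv zero_le_two)]

section SecondMoment

variable {Ω ι : Type*} [MeasurableSpace Ω] {P : Measure Ω}

lemma memLp_of_map_complexGaussian {X : Ω → ℂ} (hX : Measurable X) {v : ℝ}
    (hlaw : P.map X = complexGaussian v) : MemLp X 2 P := by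
  have h := memLp_complexGaussian v
  rw [← hlaw, memLp_map_measure_iff aestronglyMeasurable_id hX.aemeasurable] at h
  exact h

lemma integral_mul_conj_eq_zero {X Y : Ω → ℂ} (hX : Measurable X) (hY : Measurable Y) {v : ℝ}
    (hlaw : P.map X = complexGaussian v) (h : IndepFun X Y P) : ∫ ω, X ω * conj (Y ω) ∂P = 0 := by
  have h2 : IndepFun X (fun ω => conj (Y ω)) P :=
    h.comp measurable_id Complex.continuous_conj.measurable
  rw [h2.integral_fun_mul_eq_mul_integral hX.aestronglyMeasurable
    (Complex.continuous_conj.measurable.comp hY).aestronglyMeasurable]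
  have : ∫ ω, X ω ∂P = 0 := by
    rw [← integral_id_complexGaussian v, ← hlaw,
      integral_map hX.aemeasurable (Measurable.aestronglyMeasurable (by fun_prop))]
  rw [this, zero_mul]

/-- The second moment of a linear combination of independent complex Gaussians. -/
lemma integral_norm_sq_sum_mul [Fintype ι] {z : ι → Ω → ℂ} {v : ι → ℝ}
    (hv : ∀ k, 0 ≤ v k) (hz : ∀ k, Measurable (z k)) (hlaw : ∀ k, P.map (z k) = complexGaussian (v k))
    (hind : iIndepFun z P) (a : ι → ℂ) :
    ∫ ω, ‖∑ k, a k * z k ω‖ ^ 2 ∂P = ∑ k, ‖a k‖ ^ 2 * v k := by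
  classical
  have hmem (k : ι) : MemLp (z k) 2 P := memLp_of_map_complexGaussian (hz k) (hlaw k)
  have hmoment (k l : ι) : ∫ ω, z k ω * conj (z l ω) ∂P = if k = l then (v k : ℂ) else 0 := by
    split_ifs with h
    · subst h
      simp_rw [Complex.mul_conj']
      rw [← integral_norm_sq_complexGaussian (hv k), ← hlaw k, integral_map (hz k).aemeasurable
        (Measurable.aestronglyMeasurable (by fun_prop)), ← integral_complex_ofReal]
      simp
    · exact integral_mul_conj_eq_zero (hz k) (hz l) (hlaw k) (hind.indepFun h)
  have hint (k l : ι) : Integrable (fun ω => a k * conj (a l) * (z k ω * conj (z l ω))) P :=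
    (MemLp.integrable_mul (hmem k) (hmem l).star).const_mul _
  have hexp (ω : Ω) : ((‖∑ k, a k * z k ω‖ ^ 2 : ℝ) : ℂ) =
      ∑ k, ∑ l, a k * conj (a l) * (z k ω * conj (z l ω)) := by
    push_cast
    rw [← Complex.mul_conj', map_sum, Finset.sum_mul_sum]
    refine Finset.sum_congr rfl fun k _ => Finset.sum_congr rfl fun l _ => ?_
    rw [map_mul]
    ring
  rw [← Complex.ofReal_inj, ← integral_complex_ofReal]
  simp_rw [hexp]
  rw [integral_finsetSum _ fun k _ => integrable_finsetSum _ fun l _ => hint k l]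
  simp_rw [integral_finsetSum _ fun l _ => hint _ l, integral_const_mul, hmoment]
  push_cast
  refine Finset.sum_congr rfl fun k _ => ?_
  simp [Complex.mul_conj']

end SecondMoment

/-! ### Conditional expectation as an `L²` projection. -/

/-- The conditional expectation is the best mean square approximation. -/
lemma integral_norm_sq_sub_condExp_le {Ω : Type*} {m m₀ : MeasurableSpace Ω} {P : Measure[m₀] Ω}
    [IsFiniteMeasure P] (hm : m ≤ m₀) {X Z : Ω → ℂ} (hX : MemLp X 2 P) (hZ : MemLp Z 2 P)
    (hZm : StronglyMeasurable[m] Z) :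
    ∫ ω, ‖X ω - (P[X | m]) ω‖ ^ 2 ∂P ≤ ∫ ω, ‖X ω - Z ω‖ ^ 2 ∂P := by
  have hnorm (f : Lp ℂ 2 P) : ‖f‖ ^ 2 = ∫ ω, ‖f ω‖ ^ 2 ∂P := by
    rw [← RCLike.ofReal_inj (K := ℂ)]
    push_cast
    rw [← inner_self_eq_norm_sq_to_K (𝕜 := ℂ), L2.inner_def]
    simp_rw [inner_self_eq_norm_sq_to_K (𝕜 := ℂ)]
    refine Eq.trans ?_ integral_complex_ofReal
    simp
  have hmem : hZ.toLp Z ∈ lpMeas ℂ ℂ m 2 P := by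
    rw [mem_lpMeas_iff_aestronglyMeasurable]
    exact ⟨Z, hZm, hZ.coeFn_toLp⟩
  have hfact : Fact (m ≤ m₀) := ⟨hm⟩
  have hle : ‖hX.toLp X - (condExpL2 ℂ ℂ hm (hX.toLp X) : Lp ℂ 2 P)‖ ≤
      ‖hX.toLp X - hZ.toLp Z‖ := by
    have h := (lpMeas ℂ ℂ m 2 P).starProjection_minimal (hX.toLp X)
    refine h.le.trans (ciInf_le ⟨0, ?_⟩ (⟨hZ.toLp Z, hmem⟩ : lpMeas ℂ ℂ m 2 P))
    rintro _ ⟨x, rfl⟩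
    exact norm_nonneg _
  have hsq := pow_le_pow_left₀ (norm_nonneg _) hle 2
  rw [hnorm, hnorm] at hsq
  have hl : ∫ ω, ‖X ω - (P[X | m]) ω‖ ^ 2 ∂P =
      ∫ ω, ‖(hX.toLp X - (condExpL2 ℂ ℂ hm (hX.toLp X) : Lp ℂ 2 P) : Lp ℂ 2 P) ω‖ ^ 2 ∂P := by
    refine integral_congr_ae ?_
    filter_upwards [Lp.coeFn_sub (hX.toLp X) (condExpL2 ℂ ℂ hm (hX.toLp X) : Lp ℂ 2 P),
      hX.coeFn_toLp, hX.condExpL2_ae_eq_condExp (E := ℂ) (𝕜 := ℂ) hm] with ω h1 h2 h3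
    rw [h1, Pi.sub_apply, h2, h3]
  have hr : ∫ ω, ‖X ω - Z ω‖ ^ 2 ∂P = ∫ ω, ‖(hX.toLp X - hZ.toLp Z : Lp ℂ 2 P) ω‖ ^ 2 ∂P := by
    refine integral_congr_ae ?_
    filter_upwards [Lp.coeFn_sub (hX.toLp X) (hZ.toLp Z), hX.coeFn_toLp, hZ.coeFn_toLp]
      with ω h1 h2 h3
    rw [h1, Pi.sub_apply, h2, h3]
  rwa [hl, hr]

lemma memLp_condExp_two {Ω : Type*} {m m₀ : MeasurableSpace Ω} {P : Measure[m₀] Ω}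
    [IsFiniteMeasure P] (hm : m ≤ m₀) {X : Ω → ℂ} (hX : MemLp X 2 P) : MemLp (P[X | m]) 2 P :=
  (memLp_congr_ae (hX.condExpL2_ae_eq_condExp (E := ℂ) (𝕜 := ℂ) hm)).1 (Lp.memLp _)

/-! ### Matrix form of the channel and the error. -/

/-- The matrix mapping the coefficients `g` to the channel vector. -/
noncomputable def channelMatrix {M : ℕ} (lam : Fin M → ℝ) : Matrix (Fin M) (Fin M) ℂ :=
  dftMatrix M * diagonal fun m => (Real.sqrt (lam m) : ℂ)

lemma channelMatrix_mulVec {M : ℕ} (lam : Fin M → ℝ) (x : Fin M → ℂ) :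
    channelMatrix lam *ᵥ x = dftMatrix M *ᵥ fun m => (Real.sqrt (lam m) : ℂ) * x m := by
  rw [channelMatrix, ← mulVec_mulVec]
  congr 1
  ext m
  rw [mulVec_diagonal]

lemma channel_eq_mulVec {Ω : Type*} {M : ℕ} (lam : Fin M → ℝ) (g : Fin M → Ω → ℂ) (ω : Ω) :
    channel lam g ω = channelMatrix lam *ᵥ fun m => g m ω := by
  rw [channelMatrix_mulVec]
  ext i
  simp only [channel, mulVec, dotProduct]
  exact Finset.sum_congr rfl fun m _ => by ring

lemma observation_channel_eq {Ω : Type*} {M T : ℕ} (Ψ : Matrix (Fin T) (Fin M) ℂ) (lam : Fin M → ℝ) (g : Fin M → Ω → ℂ)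
    (n : Fin T → Ω → ℂ) (ω : Ω) :
    observation Ψ (channel lam g) n ω =
      fun t => ((Ψ * channelMatrix lam) *ᵥ fun m => g m ω) t + n t ω := by
  ext t
  rw [observation, channel_eq_mulVec, mulVec_mulVec]

lemma trace_errorCov {Ω : Type*} [MeasurableSpace Ω] {M : ℕ} (P : Measure Ω)
    (h hhat : Ω → Fin M → ℂ) :
    (errorCov P h hhat).trace = ((∑ i, ∫ ω, ‖h ω i - hhat ω i‖ ^ 2 ∂P : ℝ) : ℂ) := by
  simp only [errorCov, trace, diag_apply, of_apply, Complex.mul_conj', Complex.ofReal_sum,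
    ← integral_complex_ofReal, Complex.ofReal_pow]

/-- The mean square error that is left when the component of the coefficients in the range of the
projection `Q` is not observed. -/
noncomputable def residualError {M : ℕ} (B Q : Matrix (Fin M) (Fin M) ℂ) : ℝ :=
  ∑ i, ∑ m, ‖(B * Q) i m‖ ^ 2

/-! ### Error bounds in the Gaussian model. -/

namespace IsGaussianModel

variable {Ω : Type*} [MeasurableSpace Ω] {M T : ℕ} {P : Measure Ω} {N₀ : ℝ}
  {g : Fin M → Ω → ℂ} {n : Fin T → Ω → ℂ}

lemma memLp_coeff (hmod : IsGaussianModel P N₀ g n) (m : Fin M) : MemLp (g m) 2 P :=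
  memLp_of_map_complexGaussian (hmod.measurable_coeff m) (hmod.law_coeff m)

lemma memLp_noise (hmod : IsGaussianModel P N₀ g n) (t : Fin T) : MemLp (n t) 2 P :=
  memLp_of_map_complexGaussian (hmod.measurable_noise t) (hmod.law_noise t)

lemma memLp_mulVec_coeff (hmod : IsGaussianModel P N₀ g n) {κ : Type*}
    (B : Matrix κ (Fin M) ℂ) (i : κ) : MemLp (fun ω => (B *ᵥ fun m => g m ω) i) 2 P := by
  simp only [mulVec, dotProduct]
  exact memLp_finsetSum _ fun m _ => (hmod.memLp_coeff m).const_mul _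

lemma indepFun_coeff_noise (hmod : IsGaussianModel P N₀ g n) :
    IndepFun (fun ω m => g m ω) (fun ω t => n t ω) P := by
  classical
  have h := hmod.indep.indepFun_finset (Finset.univ.map Function.Embedding.inl)
    (Finset.univ.map Function.Embedding.inr)
    (by simp [Finset.disjoint_left]) (by
      rintro (m | t)
      · exact hmod.measurable_coeff m
      · exact hmod.measurable_noise t)
  exact h.comp
    (φ := fun f m => f ⟨Sum.inl m, by simp⟩) (ψ := fun f t => f ⟨Sum.inr t, by simp⟩)
    (measurable_pi_iff.2 fun _ => measurable_pi_apply _)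
    (measurable_pi_iff.2 fun _ => measurable_pi_apply _)

/-- The pair of coefficients and noise is invariant in law under unitary transformations of the
coefficients. -/
lemma identDistrib_mulVec [IsProbabilityMeasure P] (hmod : IsGaussianModel P N₀ g n)
    (U : Matrix (Fin M) (Fin M) ℂ) (hU : U * Uᴴ = 1) :
    IdentDistrib (fun ω => ((fun m => g m ω), fun t => n t ω))
      (fun ω => (U *ᵥ (fun m => g m ω), fun t => n t ω)) P P := by
  have hg : Measurable fun ω m => g m ω := measurable_pi_iff.2 hmod.measurable_coeff
  have hn : Measurable fun ω t => n t ω := measurable_pi_iff.2 hmod.measurable_noise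
  have hUm : Measurable (fun x : Fin M → ℂ => U *ᵥ x) :=
    (continuous_const.matrix_mulVec continuous_id).measurable
  have hlaw : P.map (fun ω m => g m ω) = Measure.pi fun _ => complexGaussian 1 := by
    have h := (iIndepFun_iff_map_fun_eq_pi_map fun m => (hmod.measurable_coeff m).aemeasurable).1
      (iIndepFun.precomp (g := (Sum.inl : Fin M → Fin M ⊕ Fin T)) Sum.inl_injective hmod.indep)
    simpa [hmod.law_coeff] using h
  refine IdentDistrib.prodMk ⟨hg.aemeasurable, (hUm.comp hg).aemeasurable, ?_⟩
    (IdentDistrib.refl hn.aemeasurable) hmod.indepFun_coeff_noise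
    (hmod.indepFun_coeff_noise.comp hUm measurable_id)
  change _ = P.map ((fun x => U *ᵥ x) ∘ fun ω m => g m ω)
  rw [← Measure.map_map hUm hg, hlaw, map_mulVec_pi_complexGaussian zero_le_one U hU]

lemma integral_norm_sq_mulVec_sub (hmod : IsGaussianModel P N₀ g n) (hN : 0 < N₀) {κ : Type*}
    (D : Matrix κ (Fin M) ℂ) (L : Matrix κ (Fin T) ℂ) (i : κ) :
    ∫ ω, ‖(D *ᵥ fun m => g m ω) i - (L *ᵥ fun t => n t ω) i‖ ^ 2 ∂P =
      ∑ m, ‖D i m‖ ^ 2 + N₀ * ∑ t, ‖L i t‖ ^ 2 := by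
  have h := integral_norm_sq_sum_mul (P := P) (z := Sum.elim g n)
    (v := Sum.elim (fun _ => 1) (fun _ => N₀))
    (by rintro (m | t) <;> simp [hN.le])
    (by
      rintro (m | t)
      · exact hmod.measurable_coeff m
      · exact hmod.measurable_noise t)
    (by
      rintro (m | t)
      · exact hmod.law_coeff m
      · exact hmod.law_noise t)
    hmod.indep (Sum.elim (fun m => D i m) (fun t => -L i t))
  simp only [Fintype.sum_sum_type, Sum.elim_inl, Sum.elim_inr, neg_mul, Finset.sum_neg_distrib,
    ← sub_eq_add_neg, norm_neg, mul_one] at h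
  simp only [mulVec, dotProduct]
  rw [h, Finset.mul_sum]
  simp_rw [mul_comm N₀]

/-- No estimator based on `Ψ B g + n` can recover the part of `B g` lying over the kernel of
`Ψ B`. -/
lemma residualError_le [IsProbabilityMeasure P] (hmod : IsGaussianModel P N₀ g n) (hN : 0 < N₀)
    (B Q : Matrix (Fin M) (Fin M) ℂ) (A : Matrix (Fin T) (Fin M) ℂ) (hQs : Qᴴ = Q)
    (hQQ : Q * Q = Q) (hAQ : A * Q = 0) (φ : (Fin T → ℂ) → Fin M → ℂ) (hφ : Measurable φ)
    (hmem : ∀ i, MemLp (fun ω => φ (fun t => (A *ᵥ fun m => g m ω) t + n t ω) i) 2 P) :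
    residualError B Q ≤ ∑ i, ∫ ω, ‖(B *ᵥ fun m => g m ω) i -
      φ (fun t => (A *ᵥ fun m => g m ω) t + n t ω) i‖ ^ 2 ∂P := by
  -- Reflection flipping the sign of the unobservable component `Q g`.
  set U : Matrix (Fin M) (Fin M) ℂ := 1 - (2 : ℂ) • Q with hUdef
  have hU : U * Uᴴ = 1 := by
    rw [hUdef, conjTranspose_sub, conjTranspose_one, conjTranspose_smul, hQs]
    simp only [sub_mul, mul_sub, Matrix.smul_mul, Matrix.mul_smul, hQQ, one_mul, mul_one]
    simp only [star_ofNat, smul_smul]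
    module
  have hAU (x : Fin M → ℂ) : A *ᵥ (U *ᵥ x) = A *ᵥ x := by
    rw [mulVec_mulVec, hUdef, Matrix.mul_sub, Matrix.mul_one, Matrix.mul_smul, hAQ, smul_zero, sub_zero]
  have hBU (x : Fin M → ℂ) (i : Fin M) :
      (B *ᵥ (U *ᵥ x)) i = (B *ᵥ x) i - 2 * ((B * Q) *ᵥ x) i := by
    rw [mulVec_mulVec, hUdef, mul_sub, mul_one, Matrix.mul_smul, sub_mulVec, smul_mulVec]
    simp
  refine Finset.sum_le_sum fun i _ => ?_
  set F : (Fin M → ℂ) × (Fin T → ℂ) → ℝ := fun p =>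
    ‖(B *ᵥ p.1) i - φ (fun t => (A *ᵥ p.1) t + p.2 t) i‖ ^ 2 with hF
  have hFm : Measurable F := by
    have h1 : Measurable fun p : (Fin M → ℂ) × (Fin T → ℂ) => (B *ᵥ p.1) i :=
      ((continuous_apply i).comp (continuous_const.matrix_mulVec continuous_fst)).measurable
    have h2 : Measurable fun p : (Fin M → ℂ) × (Fin T → ℂ) => fun t => (A *ᵥ p.1) t + p.2 t :=
      ((continuous_const.matrix_mulVec continuous_fst).add continuous_snd).measurable
    exact (h1.sub ((measurable_pi_apply i).comp (hφ.comp h2))).norm.pow_const 2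
  have hid := (hmod.identDistrib_mulVec U hU).comp hFm
  have hint : Integrable (fun ω => F ((fun m => g m ω), fun t => n t ω)) P :=
    ((hmod.memLp_mulVec_coeff B i).sub (hmem i)).norm.integrable_sq
  have hint' : Integrable (fun ω => F (U *ᵥ (fun m => g m ω), fun t => n t ω)) P :=
    hid.integrable_iff.1 hint
  have hq := hmod.integral_norm_sq_mulVec_sub hN (B * Q) (0 : Matrix (Fin M) (Fin T) ℂ) i
  simp only [zero_mulVec, Pi.zero_apply, sub_zero, Matrix.zero_apply, norm_zero, ne_eq,
    OfNat.ofNat_ne_zero, not_false_eq_true, zero_pow, Finset.sum_const_zero, mul_zero,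
    add_zero] at hq
  -- Parallelogram law: `‖a‖² + ‖a - 2q‖² = 2‖a - q‖² + 2‖q‖² ≥ 2‖q‖²`, with `a` and `a - 2q` the
  -- errors at `g` and `U g`.
  have hpt (ω : Ω) : 2 * ‖((B * Q) *ᵥ fun m => g m ω) i‖ ^ 2 ≤
      F ((fun m => g m ω), fun t => n t ω) + F (U *ᵥ (fun m => g m ω), fun t => n t ω) := by
    simp only [hF, hAU, hBU]
    set q := ((B * Q) *ᵥ fun m => g m ω) i
    set a := (B *ᵥ fun m => g m ω) i - φ (fun t => (A *ᵥ fun m => g m ω) t + n t ω) i with ha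
    have h1 : (B *ᵥ fun m => g m ω) i - 2 * q - φ (fun t => (A *ᵥ fun m => g m ω) t + n t ω) i =
      a - 2 * q := by rw [ha]; ring
    rw [h1]
    have h2 := parallelogram_law_with_norm ℝ (a - q) q
    have h3 : a - q + q = a := by ring
    have h4 : a - q - q = a - 2 * q := by ring
    rw [h3, h4] at h2
    nlinarith [mul_self_nonneg ‖a - q‖]
  have hle := integral_mono
    (((hmod.memLp_mulVec_coeff (B * Q) i).norm.integrable_sq).const_mul 2) (hint.add hint') hpt
  rw [integral_const_mul, hq] at hle
  have heq : ∫ ω, F (U *ᵥ (fun m => g m ω), fun t => n t ω) ∂P =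
      ∫ ω, F ((fun m => g m ω), fun t => n t ω) ∂P := hid.integral_eq.symm
  have hadd := integral_add hint hint'
  simp only [Pi.add_apply] at hle
  change ∑ m, ‖(B * Q) i m‖ ^ 2 ≤ ∫ ω, F ((fun m => g m ω), fun t => n t ω) ∂P
  linarith

variable {Ψ : Matrix (Fin T) (Fin M) ℂ} {lam : Fin M → ℝ}

lemma measurable_observation (hmod : IsGaussianModel P N₀ g n) :
    Measurable (observation Ψ (channel lam g) n) := by
  have hg : Measurable fun ω m => g m ω := measurable_pi_iff.2 hmod.measurable_coeff
  refine measurable_pi_iff.2 fun t => ?_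
  simp_rw [observation_channel_eq]
  exact (((continuous_apply t).comp
    (continuous_const.matrix_mulVec continuous_id)).measurable.comp hg).add (hmod.measurable_noise t)

lemma memLp_channel (hmod : IsGaussianModel P N₀ g n) (i : Fin M) :
    MemLp (fun ω => channel lam g ω i) 2 P := by
  simp_rw [channel_eq_mulVec]
  exact hmod.memLp_mulVec_coeff _ i

lemma memLp_observation (hmod : IsGaussianModel P N₀ g n) (t : Fin T) :
    MemLp (fun ω => observation Ψ (channel lam g) n ω t) 2 P := by
  simp_rw [observation_channel_eq]
  exact (hmod.memLp_mulVec_coeff _ t).add (hmod.memLp_noise t)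

variable [IsProbabilityMeasure P] {Q : Matrix (Fin M) (Fin M) ℂ}

lemma residualError_le_trace_errorCov (hmod : IsGaussianModel P N₀ g n) (hN : 0 < N₀)
    (hQs : Qᴴ = Q) (hQQ : Q * Q = Q) (hAQ : Ψ * channelMatrix lam * Q = 0)
    (φ : (Fin T → ℂ) → Fin M → ℂ) (hφ : Measurable φ)
    (hmem : ∀ i, MemLp (fun ω => φ (observation Ψ (channel lam g) n ω) i) 2 P) :
    residualError (channelMatrix lam) Q ≤ ∑ i, ∫ ω, ‖channel lam g ω i -
      φ (observation Ψ (channel lam g) n ω) i‖ ^ 2 ∂P := by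
  simp_rw [observation_channel_eq] at hmem
  simp_rw [observation_channel_eq, channel_eq_mulVec]
  exact hmod.residualError_le hN _ Q _ hQs hQQ hAQ φ hφ hmem

/-- The conditional expectation is measurable for the σ-algebra of `y`, hence a measurable function
of `y`, and the bound for arbitrary estimators applies. -/
lemma residualError_le_mmse (hmod : IsGaussianModel P N₀ g n) (hN : 0 < N₀)
    (hQs : Qᴴ = Q) (hQQ : Q * Q = Q) (hAQ : Ψ * channelMatrix lam * Q = 0) :
    residualError (channelMatrix lam) Q ≤ ∑ i, ∫ ω, ‖channel lam g ω i -
      mmseEstimator P (channel lam g) (observation Ψ (channel lam g) n) ω i‖ ^ 2 ∂P := by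
  have hy : Measurable (observation Ψ (channel lam g) n) := hmod.measurable_observation
  have hfac (i : Fin M) : ∃ ψ : (Fin T → ℂ) → ℂ, Measurable ψ ∧
      (fun ω => mmseEstimator P (channel lam g) (observation Ψ (channel lam g) n) ω i) =
        ψ ∘ observation Ψ (channel lam g) n :=
    Measurable.exists_eq_measurable_comp stronglyMeasurable_condExp.measurable
  choose ψ hψ hψeq using hfac
  have hval (ω : Ω) (i : Fin M) :
      mmseEstimator P (channel lam g) (observation Ψ (channel lam g) n) ω i =
        ψ i (observation Ψ (channel lam g) n ω) := congrFun (hψeq i) ω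
  simp_rw [hval]
  refine hmod.residualError_le_trace_errorCov hN hQs hQQ hAQ (fun y i => ψ i y)
    (measurable_pi_iff.2 hψ) fun i => ?_
  simp_rw [← hval]
  exact memLp_condExp_two hy.comap_le (hmod.memLp_channel i)

/-- Comparison with the linear estimator `B G y`, which recovers `B (1 - Q) g` up to noise. -/
lemma mmse_le (hmod : IsGaussianModel P N₀ g n) (hN : 0 < N₀) (G : Matrix (Fin M) (Fin T) ℂ)
    (hG : G * (Ψ * channelMatrix lam) = 1 - Q) :
    ∑ i, ∫ ω, ‖channel lam g ω i -
        mmseEstimator P (channel lam g) (observation Ψ (channel lam g) n) ω i‖ ^ 2 ∂P ≤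
      residualError (channelMatrix lam) Q +
        N₀ * ∑ i, ∑ t, ‖(channelMatrix lam * G) i t‖ ^ 2 := by
  have hy : Measurable (observation Ψ (channel lam g) n) := hmod.measurable_observation
  set L := channelMatrix lam * G with hL
  rw [residualError, Finset.mul_sum, ← Finset.sum_add_distrib]
  refine Finset.sum_le_sum fun i _ => ?_
  rw [← hmod.integral_norm_sq_mulVec_sub hN (channelMatrix lam * Q) L i]
  have hlin : Measurable fun y : Fin T → ℂ => (L *ᵥ y) i :=
    ((continuous_apply i).comp (continuous_const.matrix_mulVec continuous_id)).measurable
  have hmem : MemLp (fun ω => (L *ᵥ observation Ψ (channel lam g) n ω) i) 2 P := by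
    simp only [mulVec, dotProduct]
    exact memLp_finsetSum _ fun t _ => (hmod.memLp_observation t).const_mul _
  refine (integral_norm_sq_sub_condExp_le hy.comap_le (hmod.memLp_channel i) hmem
    (hlin.comp (comap_measurable _)).stronglyMeasurable).trans_eq ?_
  refine integral_congr_ae (ae_of_all _ fun ω => ?_)
  have hsplit : L *ᵥ observation Ψ (channel lam g) n ω =
      channelMatrix lam *ᵥ (fun m => g m ω) - (channelMatrix lam * Q) *ᵥ (fun m => g m ω) +
        L *ᵥ fun t => n t ω := by
    have h1 : observation Ψ (channel lam g) n ω =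
        (Ψ * channelMatrix lam) *ᵥ (fun m => g m ω) + fun t => n t ω := observation_channel_eq ..
    rw [h1, mulVec_add, mulVec_mulVec, hL, Matrix.mul_assoc, hG, mul_sub, mul_one, sub_mulVec]
  simp only [hsplit, channel_eq_mulVec, Pi.add_apply, Pi.sub_apply]
  congr 2
  ring

lemma tendsto_trace_errorCov_mmse {n : ℝ → Fin T → Ω → ℂ}
    (hmod : ∀ N₀ : ℝ, 0 < N₀ → IsGaussianModel P N₀ g (n N₀)) {G : Matrix (Fin M) (Fin T) ℂ}
    (hQs : Qᴴ = Q) (hQQ : Q * Q = Q) (hAQ : Ψ * channelMatrix lam * Q = 0)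
    (hG : G * (Ψ * channelMatrix lam) = 1 - Q) :
    Tendsto (fun N₀ : ℝ => (errorCov P (channel lam g)
        (mmseEstimator P (channel lam g) (observation Ψ (channel lam g) (n N₀)))).trace)
      (𝓝[>] 0) (𝓝 (residualError (channelMatrix lam) Q : ℂ)) := by
  simp_rw [trace_errorCov]
  refine (Complex.continuous_ofReal.tendsto _).comp ?_
  refine tendsto_of_tendsto_of_tendsto_of_le_of_le' tendsto_const_nhds
    (h := fun N₀ => residualError (channelMatrix lam) Q +
      N₀ * ∑ i, ∑ t, ‖(channelMatrix lam * G) i t‖ ^ 2) ?_ ?_ ?_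
  · refine tendsto_nhdsWithin_of_tendsto_nhds ?_
    have h : Continuous fun N₀ : ℝ => residualError (channelMatrix lam) Q +
      N₀ * ∑ i, ∑ t, ‖(channelMatrix lam * G) i t‖ ^ 2 := by fun_prop
    simpa using h.tendsto 0
  · filter_upwards [self_mem_nhdsWithin] with N₀ hN
    exact (hmod N₀ hN).residualError_le_mmse hN hQs hQQ hAQ
  · filter_upwards [self_mem_nhdsWithin] with N₀ hN
    exact (hmod N₀ hN).mmse_le hN G hG

end IsGaussianModel

/-! ### Pilot matrices and the sparsity threshold. -/

/-- The pilot matrix sending `c` times the first `min T M` channel entries. -/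
def truncationPilot (M T : ℕ) (c : ℝ) : Matrix (Fin T) (Fin M) ℂ :=
  of fun t m => if (t : ℕ) = m then (c : ℂ) else 0

lemma trace_truncationPilot (M T : ℕ) (c : ℝ) :
    (truncationPilot M T c * (truncationPilot M T c)ᴴ).trace = ((min T M : ℕ) * c ^ 2 : ℝ) := by
  have h (t : Fin T) : (truncationPilot M T c * (truncationPilot M T c)ᴴ) t t =
      if (t : ℕ) < M then ((c ^ 2 : ℝ) : ℂ) else 0 := by
    simp only [truncationPilot, mul_apply, conjTranspose_apply, of_apply]
    split_ifs with ht
    · rw [Finset.sum_eq_single ⟨t, ht⟩]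
      · simp [sq]
      · intro m _ hm
        rw [if_neg fun h => hm (Fin.ext h.symm), zero_mul]
      · simp
    · refine Finset.sum_eq_zero fun m _ => ?_
      rw [if_neg fun h : (t : ℕ) = m => ht (h ▸ m.isLt), zero_mul]
  simp only [trace, diag_apply, h]
  rw [Fin.sum_univ_eq_sum_range (fun t => if t < M then ((c ^ 2 : ℝ) : ℂ) else 0) T,
    ← Finset.sum_filter, Finset.sum_const]
  have hcard : (Finset.filter (fun t => t < M) (Finset.range T)).card = min T M := by
    rw [← Finset.card_range (min T M)]
    congr 1
    ext t
    simp
  rw [hcard, nsmul_eq_mul, ← Complex.ofReal_natCast, ← Complex.ofReal_mul]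

lemma truncationPilot_mulVec {M T : ℕ} (c : ℝ) (x : Fin M → ℂ) (k : Fin M) (hk : (k : ℕ) < T) :
    (truncationPilot M T c *ᵥ x) ⟨k, hk⟩ = c * x k := by
  simp only [truncationPilot, mulVec, dotProduct, of_apply]
  rw [Finset.sum_eq_single k]
  · simp
  · intro m _ hm
    rw [if_neg fun h => hm (Fin.ext h.symm), zero_mul]
  · simp

/-- With at least as many pilots as the sparsity, the truncation pilot loses nothing. -/
lemma channelMatrix_mulVec_eq_zero {M T : ℕ} {c : ℝ} (hc : c ≠ 0) (S : Finset (Fin M))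
    (hS : S.card ≤ T) (lam : Fin M → ℝ) (hlam : Function.support lam = (S : Set (Fin M)))
    (x : Fin M → ℂ) (hx : (truncationPilot M T c * channelMatrix lam) *ᵥ x = 0) :
    channelMatrix lam *ᵥ x = 0 := by
  rw [← mulVec_mulVec] at hx
  rw [channelMatrix_mulVec] at hx ⊢
  rw [eq_zero_of_dftMatrix_mulVec_eq_zero S (fun m => (Real.sqrt (lam m) : ℂ) * x m) ?_ ?_,
    mulVec_zero]
  · intro m hm
    have : lam m = 0 := by
      by_contra h
      exact hm (Finset.mem_coe.1 (hlam ▸ Function.mem_support.2 h))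
    simp [this]
  · intro k hk
    have h := congrFun hx ⟨k, hk.trans_le hS⟩
    rw [truncationPilot_mulVec] at h
    exact (mul_eq_zero.1 h).resolve_left (by exact_mod_cast hc)

/-- With fewer pilots than the sparsity, part of the channel is not observed. -/
lemma residualError_pos {M T : ℕ} (S : Finset (Fin M)) (hS : T < S.card) (lam : Fin M → ℝ)
    (hlam0 : ∀ m, 0 ≤ lam m) (hlam : Function.support lam = (S : Set (Fin M)))
    (Ψ : Matrix (Fin T) (Fin M) ℂ) {Q : Matrix (Fin M) (Fin M) ℂ} {G : Matrix (Fin M) (Fin T) ℂ}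
    (hG : G * (Ψ * channelMatrix lam) = 1 - Q) : 0 < residualError (channelMatrix lam) Q := by
  obtain ⟨v, hv0, hvS, hv⟩ :=
    exists_support_subset_mulVec_eq_zero (Ψ * channelMatrix lam) S hS
  have hQv : Q *ᵥ v = v := by
    have h : (G * (Ψ * channelMatrix lam)) *ᵥ v = 0 := by rw [← mulVec_mulVec, hv, mulVec_zero]
    rw [hG, sub_mulVec, one_mulVec, sub_eq_zero] at h
    exact h.symm
  have hBv : channelMatrix lam *ᵥ v ≠ 0 := by
    rw [channelMatrix_mulVec]
    intro h
    -- Full support makes this the injectivity of the DFT.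
    have h0 := eq_zero_of_dftMatrix_mulVec_eq_zero Finset.univ _
      (fun m hm => absurd (Finset.mem_univ m) hm) fun k _ => congrFun h k
    refine hv0 (funext fun m => ?_)
    by_cases hm : m ∈ S
    · have hne : lam m ≠ 0 := by
        rw [← Function.mem_support, hlam]
        exact hm
      have hpos : 0 < Real.sqrt (lam m) := Real.sqrt_pos.2 (lt_of_le_of_ne (hlam0 m) hne.symm)
      exact (mul_eq_zero.1 (congrFun h0 m)).resolve_left (by exact_mod_cast hpos.ne')
    · exact hvS m hm
  have hBQ : channelMatrix lam * Q ≠ 0 := by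
    intro h
    rw [← hQv, mulVec_mulVec, h, zero_mulVec] at hBv
    exact hBv rfl
  have hnonneg : 0 ≤ residualError (channelMatrix lam) Q := by
    unfold residualError
    positivity
  refine hnonneg.lt_of_ne fun h => hBQ ?_
  ext i m
  have h1 := (Finset.sum_eq_zero_iff_of_nonneg fun i _ =>
    Finset.sum_nonneg fun m _ => sq_nonneg _).1 h.symm i (Finset.mem_univ i)
  have h2 := (Finset.sum_eq_zero_iff_of_nonneg fun m _ => sq_nonneg _).1 h1 m (Finset.mem_univ m)
  simpa using h2

theorem lemma2 (M T s : ℕ) (hM : 0 < M) :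
    -- enough pilots: one (power-normalized) pilot matrix works for all supports of size `s`
    (s ≤ T → ∀ Pdl : ℝ, 0 < Pdl →
      ∃ Ψ : Matrix (Fin T) (Fin M) ℂ, (Ψ * Ψᴴ).trace = ((T * Pdl : ℝ) : ℂ) ∧
        ∀ S : Finset (Fin M), S.card = s →
        ∀ lam : Fin M → ℝ, (∀ m, 0 ≤ lam m) → Function.support lam = (S : Set (Fin M)) →
        ∀ (Ω : Type*) [MeasurableSpace Ω] (P : Measure Ω) [IsProbabilityMeasure P]
          (g : Fin M → Ω → ℂ) (n : ℝ → Fin T → Ω → ℂ),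
          (∀ N₀ : ℝ, 0 < N₀ → IsGaussianModel P N₀ g (n N₀)) →
          Tendsto (fun N₀ : ℝ =>
            (errorCov P (channel lam g)
              (mmseEstimator P (channel lam g)
                (observation Ψ (channel lam g) (n N₀)))).trace)
            (𝓝[>] 0) (𝓝 0)) ∧
    -- too few pilots: for every pilot matrix the error stays bounded away from zero
    (T < s →
      ∀ S : Finset (Fin M), S.card = s →
      ∀ lam : Fin M → ℝ, (∀ m, 0 ≤ lam m) → Function.support lam = (S : Set (Fin M)) →
      ∀ Ψ : Matrix (Fin T) (Fin M) ℂ,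
      ∃ c : ℝ, 0 < c ∧
        ∀ (Ω : Type*) [MeasurableSpace Ω] (P : Measure Ω) [IsProbabilityMeasure P]
          (g : Fin M → Ω → ℂ) (n : ℝ → Fin T → Ω → ℂ),
          (∀ N₀ : ℝ, 0 < N₀ → IsGaussianModel P N₀ g (n N₀)) →
          Tendsto (fun N₀ : ℝ =>
            (errorCov P (channel lam g)
              (mmseEstimator P (channel lam g)
                (observation Ψ (channel lam g) (n N₀)))).trace)
            (𝓝[>] 0) (𝓝 (c : ℂ)) ∧
          ∀ N₀ : ℝ, 0 < N₀ →
            ∀ φ : (Fin T → ℂ) → Fin M → ℂ, Measurable φ →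
              (∀ i, MemLp (fun ω => φ (observation Ψ (channel lam g) (n N₀) ω) i) 2 P) →
              c ≤ (errorCov P (channel lam g)
                (fun ω => φ (observation Ψ (channel lam g) (n N₀) ω))).trace.re) := by
  refine ⟨fun hsT Pdl hP => ?_, fun hTs S hS lam hlam0 hlam Ψ => ?_⟩
  -- Only `min T M` rows of the pilot are nonzero, so they carry the whole power budget. For `T = 0`
  -- both sides vanish and any nonzero `c` works.
  · obtain ⟨c, hc, htrace⟩ : ∃ c : ℝ, c ≠ 0 ∧ ((min T M : ℕ) : ℝ) * c ^ 2 = T * Pdl := by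
      rcases Nat.eq_zero_or_pos T with rfl | hT
      · exact ⟨1, one_ne_zero, by simp⟩
      · have hTR : (0 : ℝ) < T := by exact_mod_cast hT
        have hmin : (0 : ℝ) < (min T M : ℕ) := by exact_mod_cast lt_min hT hM
        have hq : 0 < T * Pdl / (min T M : ℕ) := by positivity
        refine ⟨Real.sqrt (T * Pdl / (min T M : ℕ)), (Real.sqrt_pos.2 hq).ne', ?_⟩
        rw [Real.sq_sqrt hq.le]
        field_simp
    refine ⟨truncationPilot M T c, by rw [trace_truncationPilot, htrace], ?_⟩
    intro S hS lam _ hlam Ω _ P _ g n hmod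
    obtain ⟨Q, G, hQs, hQQ, hAQ, hG⟩ :=
      exists_kernel_projection (truncationPilot M T c * channelMatrix lam)
    -- The columns of `Q` lie in `ker A`, on which this pilot forces `B` to vanish; the limit is
    -- then zero.
    have hBQ : channelMatrix lam * Q = 0 := by
      refine Matrix.ext_of_mulVec_single fun i => ?_
      rw [← mulVec_mulVec, zero_mulVec]
      refine channelMatrix_mulVec_eq_zero hc S (hS.trans_le hsT) lam hlam _ ?_
      rw [mulVec_mulVec, hAQ, zero_mulVec]
    have h := IsGaussianModel.tendsto_trace_errorCov_mmse hmod hQs hQQ hAQ hG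
    simpa [residualError, hBQ] using h
  · obtain ⟨Q, G, hQs, hQQ, hAQ, hG⟩ := exists_kernel_projection (Ψ * channelMatrix lam)
    refine ⟨residualError (channelMatrix lam) Q,
      residualError_pos S (hS ▸ hTs) lam hlam0 hlam Ψ hG, ?_⟩
    intro Ω _ P _ g n hmod
    refine ⟨IsGaussianModel.tendsto_trace_errorCov_mmse hmod hQs hQQ hAQ hG, ?_⟩
    intro N₀ hN φ hφ hmem
    rw [trace_errorCov, Complex.ofReal_re]
    exact (hmod N₀ hN).residualError_le_trace_errorCov hN hQs hQQ hAQ φ hφ hmem
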